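/- Let $(\xi_t)_{t\in\mathbb{Z}}$ be a centred stationary Gaussian sequence on a probability space whose covariance function $\rho(k)=\mathbb{E}(\xi_0\xi_k)$ satisfies $\rho(0)=1$ and $$\rho(k)=L(|k|)\,|k|^{2H-2}\qquad (k\in\mathbb{Z},\ k\neq 0),$$ where $H\in(\tfrac12,1)$ and $L:(0,\infty)\to(0,\infty)$ is slowly varying at infinity in Zygmund's sense (for every $\delta>0$, $x^{\delta}L(x)$ is increasing and $x^{-\delta}L(x)$ is decreasing for $x$ large enough), and $\lambda\mapsto L(1/\lambda)$ is of bounded variation on $(a,\pi)$ for every $a>0$. Let $0<\theta<1$ and let $X_0=0$, $X_t=\theta X_{t-1}+\xi_t$ for $t\ge 1$. For $\vartheta\in(0,1)$ and $t\in\mathbb{Z}$ put $Y^{\vartheta}_t=\sum_{j=0}^{\infty}\vartheta^{j}\xi_{t-j}$. This series converges almost surely, $Y^{\vartheta}_t$ is square integrable, $f(\vartheta):=\mathbb{E}\big[(Y^{\vartheta}_t)^2\big]$ does not depend on $t$, and $f$ is positive and strictly increasing on $(0,1)$; let $f^{-1}:f((0,1))\to(0,1)$ be its inverse. Then, almost surely,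 $\frac1n\sum_{t=1}^n X_t^2$ belongs to $f((0,1))$ for all large $n$, and the second moment estimator $$\tilde\theta_n=f^{-1}\Big(\frac1n\sum_{t=1}^n X_t^2\Big)$$ satisfies $\lim_{n\to\infty}\tilde\theta_n=\theta$ almost surely. (Where the empirical second moment is outside $f((0,1))$, the value of $\tilde\theta_n$ is arbitrary.) -/

import Mathlib

open MeasureTheory ProbabilityTheory Filter Topology Set

noncomputable section

namespace LongMemoryAR

/-- `L` is positive on `(0, ∞)` and slowly varying at infinity in Zygmund's sense: for every
`δ > 0`, for `x` large enough, `x ^ δ * L x` is increasing and `x ^ (-δ) * L x` is decreasing.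
(As `δ` is arbitrary, the weak and the strict reading of the monotonicity are equivalent.) -/
structure IsZygmundSlowlyVarying (L : ℝ → ℝ) : Prop where
  pos : ∀ x, 0 < x → 0 < L x
  increasing : ∀ δ : ℝ, 0 < δ → ∃ x₀ : ℝ, 0 < x₀ ∧ MonotoneOn (fun x => x ^ δ * L x) (Ioi x₀)
  decreasing : ∀ δ : ℝ, 0 < δ → ∃ x₀ : ℝ, 0 < x₀ ∧ AntitoneOn (fun x => x ^ (-δ) * L x) (Ioi x₀)

/-- A covariance sequence with `ρ 0 = 1` and `ρ k = L |k| * |k| ^ (2 H - 2)` for `k ≠ 0`, where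
`1 / 2 < H < 1`, `L` is slowly varying at infinity in Zygmund's sense, and `x ↦ L (1 / x)` is of
bounded variation on `(a, π)` for every `a > 0`. -/
structure IsLongMemoryCovariance (ρ : ℤ → ℝ) (H : ℝ) (L : ℝ → ℝ) : Prop where
  half_lt : 1 / 2 < H
  lt_one : H < 1
  slowlyVarying : IsZygmundSlowlyVarying L
  boundedVariation : ∀ a : ℝ, 0 < a → BoundedVariationOn (fun x => L (1 / x)) (Ioo a Real.pi)
  zero : ρ 0 = 1
  eq_of_ne_zero : ∀ k : ℤ, k ≠ 0 → ρ k = L |(k : ℝ)| * |(k : ℝ)| ^ (2 * H - 2)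

variable {Ω : Type*} [MeasurableSpace Ω]

/-- `ξ` is a centred stationary Gaussian sequence with covariance function `ρ k = E (ξ 0 * ξ k)`.
For a centred Gaussian sequence, the invariance of the covariances under time shifts is the same
thing as the invariance of all finite dimensional laws. -/
structure IsStationaryGaussianNoise (P : Measure Ω) (ξ : ℤ → Ω → ℝ) (ρ : ℤ → ℝ) : Prop where
  gaussian : IsGaussianProcess ξ P
  centred : ∀ t, ∫ ω, ξ t ω ∂P = 0
  covariance : ∀ t k : ℤ, ∫ ω, ξ t ω * ξ (t + k) ω ∂P = ρ k

/-- The autoregressive process `X t = θ * X (t - 1) + ξ t` for `t ≥ 1`, with `X 0 = 0`. -/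
def arProcess (θ : ℝ) (ξ : ℤ → Ω → ℝ) : ℕ → Ω → ℝ
  | 0 => fun _ => 0
  | t + 1 => fun ω => θ * arProcess θ ξ t ω + ξ ((t : ℤ) + 1) ω

/-- The stationary solution `Y t = ∑ θ ^ j * ξ (t - j)`, the sum being over `j ≥ 0`. -/
def statProcess (θ : ℝ) (ξ : ℤ → Ω → ℝ) (t : ℤ) (ω : Ω) : ℝ :=
  ∑' j : ℕ, θ ^ j * ξ (t - j) ω

/-- The second moment `f θ = E (Y 0 ^ 2)` of the stationary solution, as a function of `θ`. -/
def secondMoment (P : Measure Ω) (ξ : ℤ → Ω → ℝ) (θ : ℝ) : ℝ :=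
  ∫ ω, statProcess θ ξ 0 ω ^ 2 ∂P

/-- The empirical second moment `(1 / n) * ∑ X t ^ 2`, the sum being over `1 ≤ t ≤ n`. -/
def empiricalMoment (X : ℕ → Ω → ℝ) (n : ℕ) (ω : Ω) : ℝ :=
  (1 / (n : ℝ)) * ∑ t ∈ Finset.Icc 1 n, X t ω ^ 2

/-- The second moment estimator `f⁻¹ ((1 / n) * ∑ X t ^ 2)`, where `f⁻¹` is the inverse of the
function `f` on `(0, 1)` (with an arbitrary value outside the range `f (0, 1)`). -/
def momentEstimator (P : Measure Ω) (ξ : ℤ → Ω → ℝ) (X : ℕ → Ω → ℝ) (n : ℕ) (ω : Ω) : ℝ :=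
  Function.invFunOn (secondMoment P ξ) (Ioo 0 1) (empiricalMoment X n ω)

end LongMemoryAR

end

namespace LongMemoryAR

variable {Ω : Type*} [MeasurableSpace Ω] {P : Measure Ω}

/-! ### Fourth moments of Gaussian variables -/

/-! Expanding the square gives f(ϑ) = ∑ ϑ^(i+j) ρ(i-j). Since `L` is positive, all coefficients are
nonnegative, so f is continuous and strictly increasing, and `tendsto_invFunOn_Ioo` reduces
everything to the almost sure convergence of the empirical moment to f(θ).

The process X is not stationary, so this law of large numbers is proved by hand. X is centred
Gaussian, hence Cov(X_s², X_t²) = 2 (E X_s X_t)². Zygmund's condition bounds ρ(k) by a multiple of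
(1+|k|)^(-(1-H)), and the geometric weights pass this decay on to X
(`exists_abs_integral_arProcess_mul_le`). The sum of the first n squares then has variance
O(n^(2-(1-H))). Summing second moments along a polynomial subsequence gives convergence there, and
monotonicity of sums of squares fills the gaps (`tendsto_average_of_variance_bound`). The limit is
right because E X_t² is a partial sum of the double series for f(θ). -/

lemma integral_pow_four_gaussianReal_standard : ∫ x, x ^ 4 ∂(gaussianReal 0 1) = 3 := by
  rw [integral_gaussianReal_eq_integral_smul one_ne_zero]
  -- By evenness the integral is twice that over the half line, a Gamma integral stated with real
  -- exponents.
  set g : ℝ → ℝ := fun y =>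
    (√(2 * Real.pi))⁻¹ * (y ^ (4 : ℝ) * Real.exp (-(1 / 2) * y ^ (2 : ℝ))) with hg
  have h1 : ∀ x : ℝ, gaussianPDFReal 0 1 x • x ^ 4 = g |x| := by
    intro x
    have e4 : |x| ^ (4 : ℝ) = x ^ 4 := by
      rw [show (4 : ℝ) = ((4 : ℕ) : ℝ) by norm_num, Real.rpow_natCast]
      exact Even.pow_abs ⟨2, rfl⟩ x
    have e2 : |x| ^ (2 : ℝ) = x ^ 2 := by
      rw [show (2 : ℝ) = ((2 : ℕ) : ℝ) by norm_num, Real.rpow_natCast]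
      exact sq_abs x
    simp only [hg, e4, e2, gaussianPDFReal, NNReal.coe_one, smul_eq_mul, mul_one, sub_zero]
    rw [show -x ^ 2 / 2 = -(1 / 2) * x ^ 2 by ring]
    ring
  rw [integral_congr_ae (ae_of_all _ h1), integral_comp_abs (f := g), integral_const_mul,
    integral_rpow_mul_exp_neg_mul_rpow two_pos (by norm_num) (by norm_num)]
  have hG : Real.Gamma ((4 + 1) / 2) = 3 / 4 * √Real.pi := by
    rw [show ((4 : ℝ) + 1) / 2 = 3 / 2 + 1 by norm_num, Real.Gamma_add_one (by norm_num),
      show (3 : ℝ) / 2 = 1 / 2 + 1 by norm_num, Real.Gamma_add_one (by norm_num),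
      Real.Gamma_one_half_eq]
    ring
  have hp : ((1 : ℝ) / 2) ^ (-(4 + 1) / 2 : ℝ) = 4 * √2 := by
    rw [one_div, Real.inv_rpow (by norm_num), ← Real.rpow_neg (by norm_num),
      show -(-(4 + 1) / 2 : ℝ) = 2 + 1 / 2 by norm_num, Real.rpow_add (by norm_num),
      ← Real.sqrt_eq_rpow]
    norm_num
  rw [hG, hp, Real.sqrt_mul (by norm_num)]
  have h2 : √2 ≠ 0 := by positivity
  have hpi : √Real.pi ≠ 0 := by positivity
  field_simp

lemma integral_pow_four_gaussianReal (v : NNReal) :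
    ∫ x, x ^ 4 ∂(gaussianReal 0 v) = 3 * (v : ℝ) ^ 2 := by
  have hv : gaussianReal 0 v = (gaussianReal 0 1).map (√(v : ℝ) * ·) := by
    rw [gaussianReal_map_const_mul]
    congr 1
    · simp
    · ext; simp
  rw [hv, integral_map (by fun_prop) (by fun_prop)]
  simp_rw [mul_pow]
  rw [integral_const_mul, integral_pow_four_gaussianReal_standard,
    show √(v : ℝ) ^ 4 = (√(v : ℝ) ^ 2) ^ 2 by ring, Real.sq_sqrt v.coe_nonneg, mul_comm]

lemma integral_pow_four_of_hasGaussianLaw {U : Ω → ℝ} (hU : HasGaussianLaw U P)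
    (h0 : ∫ ω, U ω ∂P = 0) : ∫ ω, U ω ^ 4 ∂P = 3 * (∫ ω, U ω ^ 2 ∂P) ^ 2 := by
  have hm := hU.map_eq_gaussianReal
  have hvar : Var[U; P] = ∫ ω, U ω ^ 2 ∂P := variance_of_integral_eq_zero hU.aemeasurable h0
  rw [h0, hvar] at hm
  have h := integral_map (μ := P) hU.aemeasurable (f := fun x : ℝ => x ^ 4) (by fun_prop)
  rw [← h, hm, integral_pow_four_gaussianReal,
    Real.coe_toNNReal _ (integral_nonneg fun _ => sq_nonneg _)]

lemma integrable_pow_of_hasGaussianLaw {U : Ω → ℝ} (hU : HasGaussianLaw U P) {n : ℕ} (hn : n ≠ 0) :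
    Integrable (fun ω => U ω ^ n) P := by
  have h := (hU.memLp (p := n) (by simp)).integrable_norm_pow hn
  refine (integrable_norm_iff ?_).1 ?_
  · exact (hU.aemeasurable.pow_const n).aestronglyMeasurable
  · simpa using h

/-- Isserlis' formula for the mixed second moments of a centred Gaussian pair. -/
lemma integral_sq_mul_sq_of_hasGaussianLaw {U V : Ω → ℝ}
    (hUV : HasGaussianLaw (fun ω => (U ω, V ω)) P)
    (hU0 : ∫ ω, U ω ∂P = 0) (hV0 : ∫ ω, V ω ∂P = 0) :
    Integrable (fun ω => U ω ^ 2 * V ω ^ 2) P ∧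
    ∫ ω, U ω ^ 2 * V ω ^ 2 ∂P =
      (∫ ω, U ω ^ 2 ∂P) * (∫ ω, V ω ^ 2 ∂P) + 2 * (∫ ω, U ω * V ω ∂P) ^ 2 := by
  have hU := hUV.fst
  have hV := hUV.snd
  have hA := hUV.fun_add
  have hS := hUV.fun_sub
  have hA0 : ∫ ω, (U ω + V ω) ∂P = 0 := by
    rw [integral_add hU.integrable hV.integrable, hU0, hV0, add_zero]
  have hS0 : ∫ ω, (U ω - V ω) ∂P = 0 := by
    rw [integral_sub hU.integrable hV.integrable, hU0, hV0, sub_zero]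
  have iU := integrable_pow_of_hasGaussianLaw hU (n := 4) (by norm_num)
  have iV := integrable_pow_of_hasGaussianLaw hV (n := 4) (by norm_num)
  have iA := integrable_pow_of_hasGaussianLaw hA (n := 4) (by norm_num)
  have iS := integrable_pow_of_hasGaussianLaw hS (n := 4) (by norm_num)
  have iU2 := integrable_pow_of_hasGaussianLaw hU (n := 2) (by norm_num)
  have iV2 := integrable_pow_of_hasGaussianLaw hV (n := 2) (by norm_num)
  have iUV2 : Integrable (fun ω => U ω ^ 2 + V ω ^ 2) P := iU2.add iV2
  have iUV : Integrable (fun ω => U ω * V ω) P := hU.memLp_two.integrable_mul hV.memLp_two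
  -- Polarisation: `U`, `V`, `U + V` and `U - V` are all centred Gaussian, so only fourth moments of
  -- single variables are needed.
  have e : (fun ω => U ω ^ 2 * V ω ^ 2) = fun ω =>
      (1 / 12) * (((U ω + V ω) ^ 4 + (U ω - V ω) ^ 4) - (2 * U ω ^ 4 + 2 * V ω ^ 4)) := by
    ext ω; ring
  have eA : ∫ ω, (U ω + V ω) ^ 2 ∂P =
      (∫ ω, U ω ^ 2 ∂P) + (∫ ω, V ω ^ 2 ∂P) + 2 * ∫ ω, U ω * V ω ∂P := by
    rw [← integral_const_mul, ← integral_add iU2 iV2,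
      ← integral_add iUV2 (iUV.const_mul 2)]
    congr 1; ext ω; ring
  have eS : ∫ ω, (U ω - V ω) ^ 2 ∂P =
      (∫ ω, U ω ^ 2 ∂P) + (∫ ω, V ω ^ 2 ∂P) - 2 * ∫ ω, U ω * V ω ∂P := by
    rw [← integral_const_mul, ← integral_add iU2 iV2,
      ← integral_sub iUV2 (iUV.const_mul 2)]
    congr 1; ext ω; ring
  have iAS : Integrable (fun ω => (U ω + V ω) ^ 4 + (U ω - V ω) ^ 4) P := iA.add iS
  have iUV4 : Integrable (fun ω => 2 * U ω ^ 4 + 2 * V ω ^ 4) P :=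
    (iU.const_mul 2).add (iV.const_mul 2)
  have iR : Integrable (fun ω => ((U ω + V ω) ^ 4 + (U ω - V ω) ^ 4) -
      (2 * U ω ^ 4 + 2 * V ω ^ 4)) P :=
    iAS.sub iUV4
  refine ⟨by rw [e]; exact iR.const_mul _, ?_⟩
  rw [e, integral_const_mul, integral_sub iAS iUV4,
    integral_add iA iS, integral_add (iU.const_mul 2) (iV.const_mul 2), integral_const_mul,
    integral_const_mul, integral_pow_four_of_hasGaussianLaw hA hA0,
    integral_pow_four_of_hasGaussianLaw hS hS0, integral_pow_four_of_hasGaussianLaw hU hU0,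
    integral_pow_four_of_hasGaussianLaw hV hV0, eA, eS]
  ring

/-! ### A strong law for nonnegative variables -/

lemma ae_summable_of_summable_integral_norm {F : ℕ → Ω → ℝ} (hF : ∀ i, Integrable (F i) P)
    (hs : Summable fun i => ∫ ω, ‖F i ω‖ ∂P) : ∀ᵐ ω ∂P, Summable fun i => ‖F i ω‖ := by
  have h1 : ∫⁻ ω, ∑' i, ‖F i ω‖ₑ ∂P ≠ ⊤ := by
    rw [lintegral_tsum fun i => (hF i).1.enorm]
    have : ∀ i, ∫⁻ ω, ‖F i ω‖ₑ ∂P = ENNReal.ofReal (∫ ω, ‖F i ω‖ ∂P) := fun i =>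
      (ofReal_integral_norm_eq_lintegral_enorm (hF i)).symm
    simp_rw [this]
    exact hs.tsum_ofReal_ne_top
  have h2 := ae_lt_top' (AEMeasurable.tsum fun i => (hF i).1.enorm) h1
  filter_upwards [h2] with ω hω
  have h3 : Summable fun i => ‖F i ω‖₊ := ENNReal.tsum_coe_ne_top_iff_summable.1 hω.ne
  exact NNReal.summable_coe.2 h3

/-- Bernoulli's inequality for (1 - 1/(n+1))^(1-ε) shows that one step of n^(1-ε) is at least
(1-ε)(n+1)^(-ε). -/
lemma sum_range_rpow_neg_le {ε : ℝ} (h0 : 0 < ε) (h1 : ε < 1) (n : ℕ) :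
    ∑ d ∈ Finset.range n, (1 + (d : ℝ)) ^ (-ε) ≤ (1 - ε)⁻¹ * (n : ℝ) ^ (1 - ε) := by
  induction n with
  | zero => simp [Real.zero_rpow (by linarith : (1 - ε) ≠ 0)]
  | succ n ih =>
    rw [Finset.sum_range_succ]
    have hn : (0 : ℝ) < n + 1 := by positivity
    have hs : -1 ≤ -((n : ℝ) + 1)⁻¹ := by
      have : ((n : ℝ) + 1)⁻¹ ≤ 1 :=
        inv_le_one_of_one_le₀ (by linarith [(Nat.cast_nonneg n : (0 : ℝ) ≤ n)])
      linarith
    have hb := rpow_one_add_le_one_add_mul_self hs (by linarith : 0 ≤ 1 - ε) (by linarith)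
    have e : (n : ℝ) = (n + 1) * (1 + -((n : ℝ) + 1)⁻¹) := by field_simp; ring
    have hpow : (n : ℝ) ^ (1 - ε) ≤
        ((n : ℝ) + 1) ^ (1 - ε) * (1 + (1 - ε) * -((n : ℝ) + 1)⁻¹) := by
      conv_lhs => rw [e]
      rw [Real.mul_rpow hn.le (by linarith)]
      gcongr
    have hm : ((n : ℝ) + 1) ^ (1 - ε) * ((n : ℝ) + 1)⁻¹ = (1 + (n : ℝ)) ^ (-ε) := by
      rw [← Real.rpow_neg_one, ← Real.rpow_add hn, add_comm (1 : ℝ) n]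
      congr 1; ring
    have hε : (1 - ε)⁻¹ * (1 - ε) = 1 := inv_mul_cancel₀ (by linarith)
    have hi : 0 ≤ (1 - ε)⁻¹ := inv_nonneg.2 (by linarith)
    push_cast
    have := mul_le_mul_of_nonneg_left hpow hi
    have e2 : (1 - ε)⁻¹ * (((n : ℝ) + 1) ^ (1 - ε) * (1 + (1 - ε) * -((n : ℝ) + 1)⁻¹)) =
        (1 - ε)⁻¹ * ((n : ℝ) + 1) ^ (1 - ε) - (1 + (n : ℝ)) ^ (-ε) := by
      rw [← hm]
      linear_combination (-(((n : ℝ) + 1) ^ (1 - ε) * ((n : ℝ) + 1)⁻¹)) * hε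
    linarith

/-- Enlarging the square by one adds a row and a column, each g(1) + ... + g(n), and a corner g(0).
-/
lemma sum_range_sum_range_dist_le {g : ℕ → ℝ} (hg : ∀ d, 0 ≤ g d) (n : ℕ) :
    ∑ s ∈ Finset.range n, ∑ t ∈ Finset.range n, g (Nat.dist s t) ≤
      2 * n * ∑ d ∈ Finset.range n, g d := by
  induction n with
  | zero => simp
  | succ n ih =>
    have hrow : ∑ s ∈ Finset.range n, g (Nat.dist s n) =
        ∑ d ∈ Finset.range n, g (d + 1) := by
      rw [← Finset.sum_range_reflect]
      refine Finset.sum_congr rfl fun d hd => ?_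
      have := Finset.mem_range.1 hd
      congr 1
      simp only [Nat.dist]; omega
    have hcol : ∑ t ∈ Finset.range n, g (Nat.dist n t) =
        ∑ d ∈ Finset.range n, g (d + 1) := by
      rw [← hrow]; simp_rw [Nat.dist_comm n]
    have hG : ∑ d ∈ Finset.range (n + 1), g d = ∑ d ∈ Finset.range n, g (d + 1) + g 0 :=
      Finset.sum_range_succ' _ _
    have hmono : ∑ d ∈ Finset.range n, g d ≤ ∑ d ∈ Finset.range (n + 1), g d :=
      Finset.sum_le_sum_of_subset_of_nonneg (by simp) fun i _ _ => hg i
    simp_rw [Finset.sum_range_succ (fun t => g (Nat.dist _ t))]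
    rw [Finset.sum_range_succ, Finset.sum_add_distrib, hrow, hcol, Nat.dist_self]
    have h0 := hg 0
    have : 2 * (n : ℝ) * ∑ d ∈ Finset.range n, g d ≤
        2 * (n : ℝ) * ∑ d ∈ Finset.range (n + 1), g d := by gcongr
    push_cast
    have := hG
    nlinarith

lemma tendsto_succ_pow_div_pow (K : ℕ) :
    Tendsto (fun m : ℕ => (((m + 2) ^ K : ℕ) : ℝ) / (((m + 1) ^ K : ℕ) : ℝ)) atTop (𝓝 1) := by
  have h : Tendsto (fun m : ℕ => (1 + 1 / ((m : ℝ) + 1)) ^ K) atTop (𝓝 ((1 + 0) ^ K)) :=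
    (tendsto_const_nhds.add tendsto_one_div_add_atTop_nhds_zero_nat).pow K
  simp only [add_zero, one_pow] at h
  refine h.congr fun m => ?_
  push_cast
  rw [← div_pow]
  congr 1
  field_simp
  ring

/-- A strong law of large numbers for nonnegative square integrable variables whose partial sums
have a variance that grows slower than the square by a power. -/
theorem tendsto_average_of_variance_bound [IsProbabilityMeasure P] {W : ℕ → Ω → ℝ}
    (hW0 : ∀ i ω, 0 ≤ W i ω) (hW : ∀ i, MemLp (W i) 2 P) {C ε l : ℝ} (hε : 0 < ε)
    (hvar : ∀ n : ℕ, ∫ ω, (∑ i ∈ Finset.range n, (W i ω - ∫ ω', W i ω' ∂P)) ^ 2 ∂P ≤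
      C * (n : ℝ) ^ (2 - ε))
    (hl : Tendsto (fun i => ∫ ω, W i ω ∂P) atTop (𝓝 l)) :
    ∀ᵐ ω ∂P, Tendsto (fun n : ℕ => (∑ i ∈ Finset.range n, W i ω) / n) atTop (𝓝 l) := by
  set e : ℕ → ℝ := fun i => ∫ ω, W i ω ∂P with he
  -- Along (m+1)^K the normalised variances are O((m+1)^(-Kε)); Kε > 2 allows comparison with ∑
  -- 1/m².
  obtain ⟨K, hK⟩ := exists_nat_gt (2 / ε)
  have hKε : 2 < K * ε := by rwa [div_lt_iff₀ hε] at hK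
  have hK0 : K ≠ 0 := by rintro rfl; simp at hKε; linarith
  set c : ℕ → ℕ := fun m => (m + 1) ^ K with hc
  have hcpos : ∀ m, (0 : ℝ) < c m := fun m => by simp only [hc]; positivity
  have hctop : Tendsto c atTop atTop :=
    (tendsto_pow_atTop hK0).comp (tendsto_add_atTop_nat 1)
  set F : ℕ → Ω → ℝ := fun m ω => ((∑ i ∈ Finset.range (c m), (W i ω - e i)) / c m) ^ 2 with hF
  have hFi : ∀ m, Integrable (F m) P := by
    intro m
    have h1 : MemLp (fun ω => ∑ i ∈ Finset.range (c m), (W i ω - e i)) 2 P :=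
      memLp_finsetSum _ fun i _ => (hW i).sub (memLp_const _)
    have h2 := (h1.integrable_sq).div_const ((c m : ℝ) ^ 2)
    simpa only [hF, div_pow] using h2
  have hFb : ∀ m, ∫ ω, ‖F m ω‖ ∂P ≤ C * (1 / ((m : ℝ) + 1) ^ (2 : ℝ)) := by
    intro m
    have hC : 0 ≤ C := by
      have := hvar 1
      simp only [Nat.cast_one, Real.one_rpow, mul_one] at this
      exact (integral_nonneg fun _ => sq_nonneg _).trans this
    have h1 : ∀ ω, ‖F m ω‖ = (∑ i ∈ Finset.range (c m), (W i ω - e i)) ^ 2 / (c m : ℝ) ^ 2 := by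
      intro ω
      rw [Real.norm_of_nonneg (sq_nonneg _)]
      simp only [div_pow]
    simp_rw [h1]
    rw [integral_div]
    calc _ ≤ C * (c m : ℝ) ^ (2 - ε) / (c m : ℝ) ^ 2 := by gcongr; exact hvar _
      _ = C * (c m : ℝ) ^ (-ε) := by
        rw [mul_div_assoc, ← Real.rpow_natCast (c m : ℝ) 2, ← Real.rpow_sub (hcpos m)]
        congr 2; push_cast; ring
      _ = C * ((m : ℝ) + 1) ^ (-(K * ε)) := by
        simp only [hc]
        push_cast
        rw [← Real.rpow_natCast_mul (by positivity)]
        congr 2; ring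
      _ ≤ C * ((m : ℝ) + 1) ^ (-2 : ℝ) := by
        gcongr
        linarith [(Nat.cast_nonneg m : (0:ℝ) ≤ m)]
      _ = _ := by rw [Real.rpow_neg (by positivity), one_div]
  have hsum : Summable fun m => ∫ ω, ‖F m ω‖ ∂P := by
    refine Summable.of_nonneg_of_le (fun m => integral_nonneg fun _ => norm_nonneg _)
      hFb (Summable.mul_left C ?_)
    have := (summable_nat_add_iff 1).2 (Real.summable_one_div_nat_rpow.2 one_lt_two)
    simpa using this
  have hces : Tendsto (fun n : ℕ => (∑ i ∈ Finset.range n, e i) / n) atTop (𝓝 l) := by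
    have := hl.cesaro
    simpa [div_eq_inv_mul] using this
  filter_upwards [ae_summable_of_summable_integral_norm hFi hsum] with ω hω
  -- The partial sums are monotone and c(m+1)/c(m) → 1, so convergence along `c` forces convergence
  -- of the whole sequence of averages.
  refine tendsto_div_of_monotone_of_exists_subseq_tendsto_div _ l ?_ fun a ha => ⟨c, ?_, hctop, ?_⟩
  · intro m n hmn
    exact Finset.sum_le_sum_of_subset_of_nonneg (by simpa using hmn) fun i _ _ => hW0 i ω
  · filter_upwards [(tendsto_succ_pow_div_pow K).eventually_lt_const ha] with m hm
    rw [div_lt_iff₀ (hcpos m)] at hm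
    exact hm.le
  · have h0 : Tendsto (fun m => F m ω) atTop (𝓝 0) :=
      tendsto_zero_iff_norm_tendsto_zero.2 hω.tendsto_atTop_zero
    have h1 : Tendsto (fun m => (∑ i ∈ Finset.range (c m), (W i ω - e i)) / c m) atTop (𝓝 0) := by
      have := h0.sqrt
      simp only [hF, Real.sqrt_sq_eq_abs, Real.sqrt_zero] at this
      exact tendsto_zero_iff_abs_tendsto_zero _ |>.2 this
    have h2 := h1.add (hces.comp hctop)
    rw [zero_add] at h2
    refine h2.congr fun m => ?_
    simp only [Function.comp, Finset.sum_sub_distrib]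
    ring

/-- The strong law of large numbers for the squares of a centred Gaussian sequence whose
correlations decay like a power. -/
theorem tendsto_average_sq_of_isGaussianProcess [IsProbabilityMeasure P] {Z : ℕ → Ω → ℝ}
    (hZ : IsGaussianProcess Z P) (h0 : ∀ i, ∫ ω, Z i ω ∂P = 0) {B ε l : ℝ}
    (hε0 : 0 < ε) (hε1 : ε < 1)
    (hcov : ∀ i j, |∫ ω, Z i ω * Z j ω ∂P| ≤ B * (1 + (Nat.dist i j : ℝ)) ^ (-ε))
    (hl : Tendsto (fun i => ∫ ω, Z i ω ^ 2 ∂P) atTop (𝓝 l)) :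
    ∀ᵐ ω ∂P, Tendsto (fun n : ℕ => (∑ i ∈ Finset.range n, Z i ω ^ 2) / n) atTop (𝓝 l) := by
  have hW : ∀ i, MemLp (fun ω => Z i ω ^ 2) 2 P := by
    intro i
    have hi := hZ.hasGaussianLaw_eval i
    rw [memLp_two_iff_integrable_sq (hi.aemeasurable.pow_const 2).aestronglyMeasurable]
    have := integrable_pow_of_hasGaussianLaw hi (n := 4) (by norm_num)
    refine this.congr (ae_of_all _ fun ω => ?_)
    ring
  refine tendsto_average_of_variance_bound (W := fun i ω => Z i ω ^ 2)
    (C := 2 * B ^ 2 * (2 * (1 - ε)⁻¹)) (fun i ω => sq_nonneg _) hW hε0 (fun n => ?_) hl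
  set e : ℕ → ℝ := fun i => ∫ ω, Z i ω ^ 2 ∂P with he
  have hWe : ∀ i, MemLp (fun ω => Z i ω ^ 2 - e i) 2 P := fun i => (hW i).sub (memLp_const _)
  have hint : ∀ i j, Integrable (fun ω => (Z i ω ^ 2 - e i) * (Z j ω ^ 2 - e j)) P :=
    fun i j => (hWe i).integrable_mul (hWe j)
  have hval : ∀ i j, ∫ ω, (Z i ω ^ 2 - e i) * (Z j ω ^ 2 - e j) ∂P =
      2 * (∫ ω, Z i ω * Z j ω ∂P) ^ 2 := by
    intro i j
    obtain ⟨hI, hE⟩ := integral_sq_mul_sq_of_hasGaussianLaw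
      (hZ.hasGaussianLaw_prodMk (s := i) (t := j)) (h0 i) (h0 j)
    have hi : Integrable (fun ω => Z i ω ^ 2) P :=
      integrable_pow_of_hasGaussianLaw (hZ.hasGaussianLaw_eval i) two_ne_zero
    have hj : Integrable (fun ω => Z j ω ^ 2) P :=
      integrable_pow_of_hasGaussianLaw (hZ.hasGaussianLaw_eval j) two_ne_zero
    have e1 : (fun ω => (Z i ω ^ 2 - e i) * (Z j ω ^ 2 - e j)) = fun ω =>
        (Z i ω ^ 2 * Z j ω ^ 2 - e j * Z i ω ^ 2) - (e i * Z j ω ^ 2 - e i * e j) := by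
      ext ω; ring
    have i1 : Integrable (fun ω => Z i ω ^ 2 * Z j ω ^ 2 - e j * Z i ω ^ 2) P :=
      hI.sub (hi.const_mul _)
    have i2 : Integrable (fun ω => e i * Z j ω ^ 2 - e i * e j) P :=
      (hj.const_mul _).sub (integrable_const _)
    rw [e1, integral_sub i1 i2, integral_sub hI (hi.const_mul _),
      integral_sub (hj.const_mul _) (integrable_const _), integral_const_mul, integral_const_mul,
      hE, integral_const, probReal_univ, one_smul]
    simp only [he]
    ring
  have hbound : ∀ i j, ∫ ω, (Z i ω ^ 2 - e i) * (Z j ω ^ 2 - e j) ∂P ≤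
      2 * B ^ 2 * (1 + (Nat.dist i j : ℝ)) ^ (-ε) := by
    intro i j
    have hd : (1 : ℝ) ≤ 1 + (Nat.dist i j : ℝ) := by simp
    have hp0 : 0 ≤ (1 + (Nat.dist i j : ℝ)) ^ (-ε) := by positivity
    have hp1 : (1 + (Nat.dist i j : ℝ)) ^ (-ε) ≤ 1 :=
      Real.rpow_le_one_of_one_le_of_nonpos hd (by linarith)
    rw [hval]
    calc 2 * (∫ ω, Z i ω * Z j ω ∂P) ^ 2
        ≤ 2 * (B * (1 + (Nat.dist i j : ℝ)) ^ (-ε)) ^ 2 := by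
          rw [← sq_abs (∫ ω, Z i ω * Z j ω ∂P)]
          gcongr
          exact hcov i j
      _ = 2 * B ^ 2 * ((1 + (Nat.dist i j : ℝ)) ^ (-ε) * (1 + (Nat.dist i j : ℝ)) ^ (-ε)) := by
          ring
      -- One decay factor is dropped: ε < 1 already gives a power saving, whereas 2ε might exceed 1.
      _ ≤ 2 * B ^ 2 * ((1 + (Nat.dist i j : ℝ)) ^ (-ε) * 1) := by gcongr
      _ = _ := by ring
  have hexp : ∀ ω, (∑ i ∈ Finset.range n, (Z i ω ^ 2 - e i)) ^ 2 =
      ∑ i ∈ Finset.range n, ∑ j ∈ Finset.range n, (Z i ω ^ 2 - e i) * (Z j ω ^ 2 - e j) := by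
    intro ω; rw [sq, Finset.sum_mul_sum]
  rw [integral_congr_ae (ae_of_all _ hexp),
    integral_finsetSum _ fun i _ => integrable_finsetSum _ fun j _ => hint i j]
  rw [Finset.sum_congr rfl fun i _ => integral_finsetSum _ fun j _ => hint i j]
  calc _ ≤ ∑ i ∈ Finset.range n, ∑ j ∈ Finset.range n,
        2 * B ^ 2 * (1 + (Nat.dist i j : ℝ)) ^ (-ε) := by
        gcongr with i _ j _
        exact hbound i j
    _ = 2 * B ^ 2 * ∑ i ∈ Finset.range n, ∑ j ∈ Finset.range n,
        (1 + (Nat.dist i j : ℝ)) ^ (-ε) := by simp_rw [Finset.mul_sum]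
    _ ≤ 2 * B ^ 2 * (2 * n * ((1 - ε)⁻¹ * (n : ℝ) ^ (1 - ε))) := by
        gcongr
        refine (sum_range_sum_range_dist_le (g := fun d => (1 + (d : ℝ)) ^ (-ε))
          (fun d => by positivity) n).trans ?_
        gcongr
        exact sum_range_rpow_neg_le hε0 hε1 n
    _ = 2 * B ^ 2 * (2 * (1 - ε)⁻¹) * ((n : ℝ) ^ (1 : ℝ) * (n : ℝ) ^ (1 - ε)) := by
        rw [Real.rpow_one]; ring
    _ = _ := by
        rw [← Real.rpow_add_of_nonneg n.cast_nonneg zero_le_one (by linarith)]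
        congr 2; ring

/-! ### The inverse of a continuous strictly increasing function -/

/-- For c < θ < d, eventually u n lies between f c and f d. Continuity serves only to place u n in
the image of (c, d); injectivity then identifies the chosen preimage. -/
lemma tendsto_invFunOn_Ioo {f : ℝ → ℝ} {a b θ : ℝ} (hf : StrictMonoOn f (Ioo a b))
    (hc : ContinuousOn f (Ioo a b)) (hθ : θ ∈ Ioo a b) {u : ℕ → ℝ}
    (hu : Tendsto u atTop (𝓝 (f θ))) :
    (∀ᶠ n in atTop, u n ∈ f '' Ioo a b) ∧
      Tendsto (fun n => Function.invFunOn f (Ioo a b) (u n)) atTop (𝓝 θ) := by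
  have key : ∀ c ∈ Ioo a θ, ∀ d ∈ Ioo θ b, ∀ᶠ n in atTop, u n ∈ f '' Ioo c d := by
    intro c hcθ d hd
    have hcm : c ∈ Ioo a b := ⟨hcθ.1, hcθ.2.trans hθ.2⟩
    have hdm : d ∈ Ioo a b := ⟨hθ.1.trans hd.1, hd.2⟩
    filter_upwards [hu.eventually_const_lt (hf hcm hθ hcθ.2),
      hu.eventually_lt_const (hf hθ hdm hd.1)] with n h1 h2
    exact intermediate_value_Ioo (hcθ.2.trans hd.1).le
      (hc.mono (Icc_subset_Ioo hcm.1 hdm.2)) ⟨h1, h2⟩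
  have key2 : ∀ c ∈ Ioo a θ, ∀ d ∈ Ioo θ b,
      ∀ᶠ n in atTop, Function.invFunOn f (Ioo a b) (u n) ∈ Ioo c d := by
    intro c hcθ d hd
    filter_upwards [key c hcθ d hd] with n hn
    obtain ⟨x, hx, hxu⟩ := hn
    have hxm : x ∈ Ioo a b := ⟨hcθ.1.trans hx.1, hx.2.trans hd.2⟩
    rw [← hxu, hf.injOn.leftInvOn_invFunOn hxm]
    exact hx
  obtain ⟨c, hcθ⟩ := exists_between hθ.1
  obtain ⟨d, hd⟩ := exists_between hθ.2
  refine ⟨(key c hcθ d hd).mono fun n hn => image_mono (Ioo_subset_Ioo hcθ.1.le hd.2.le) hn, ?_⟩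
  refine tendsto_order.2 ⟨fun c' hc' => ?_, fun d' hd' => ?_⟩
  · filter_upwards [key2 (max c c') ⟨lt_max_of_lt_left hcθ.1, max_lt hcθ.2 hc'⟩ d hd] with n hn
    exact (le_max_right _ _).trans_lt hn.1
  · filter_upwards [key2 c hcθ (min d d') ⟨lt_min hd.1 hd', min_lt_of_left_lt hd.2⟩] with n hn
    exact hn.2.trans_le (min_le_right _ _)

variable {ξ : ℤ → Ω → ℝ} {ρ : ℤ → ℝ} {H : ℝ} {L : ℝ → ℝ}

/-! ### The covariance function -/

lemma IsLongMemoryCovariance.nonneg (hρ : IsLongMemoryCovariance ρ H L) (k : ℤ) : 0 ≤ ρ k := by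
  rcases eq_or_ne k 0 with rfl | hk
  · rw [hρ.zero]; exact zero_le_one
  · rw [hρ.eq_of_ne_zero k hk]
    have : 0 < |(k : ℝ)| := abs_pos.2 (by exact_mod_cast hk)
    exact mul_nonneg (hρ.slowlyVarying.pos _ this).le (by positivity)

/-- Half of the exponent 2H - 2 absorbs `L`, by Zygmund's condition with δ = 1 - H; the other half
is the decay that remains. -/
lemma IsLongMemoryCovariance.exists_le_rpow (hρ : IsLongMemoryCovariance ρ H L)
    (h1 : ∀ k, ρ k ≤ 1) :
    ∃ C, 0 ≤ C ∧ ∀ k, ρ k ≤ C * (1 + |(k : ℝ)|) ^ (-(1 - H)) := by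
  have hH : 0 < 1 - H := sub_pos.2 hρ.lt_one
  obtain ⟨x₀, hx₀, hanti⟩ := hρ.slowlyVarying.decreasing (1 - H) hH
  have hy : 0 < x₀ + 1 := by linarith
  set M := (x₀ + 1) ^ (-(1 - H)) * L (x₀ + 1) with hM
  have hM0 : 0 < M := mul_pos (by positivity) (hρ.slowlyVarying.pos _ hy)
  -- The first constant handles |k| ≥ x₀ + 1, where 1 + |k| ≤ 2|k|; the second handles smaller |k|,
  -- using ρ ≤ 1.
  refine ⟨M * 2 ^ (1 - H) + (x₀ + 2) ^ (1 - H), by positivity, fun k => ?_⟩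
  have hk0 : 0 ≤ |(k : ℝ)| := abs_nonneg _
  have hq : 0 ≤ (1 + |(k : ℝ)|) ^ (-(1 - H)) := by positivity
  rw [add_mul]
  rcases le_total |(k : ℝ)| (x₀ + 1) with hk | hk
  · have : 1 ≤ (x₀ + 2) ^ (1 - H) * (1 + |(k : ℝ)|) ^ (-(1 - H)) := by
      rw [Real.rpow_neg (by positivity), ← div_eq_mul_inv, one_le_div (by positivity)]
      exact Real.rpow_le_rpow (by positivity) (by linarith) hH.le
    have h2 : 0 ≤ M * 2 ^ (1 - H) * (1 + |(k : ℝ)|) ^ (-(1 - H)) := by positivity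
    linarith [h1 k]
  · have hkp : 0 < |(k : ℝ)| := by linarith
    have hk' : k ≠ 0 := by rintro rfl; simp at hkp
    have hL : |(k : ℝ)| ^ (-(1 - H)) * L |(k : ℝ)| ≤ M :=
      hanti (by simp) (by simp only [mem_Ioi]; linarith) hk
    have h3 : ρ k = (|(k : ℝ)| ^ (-(1 - H)) * L |(k : ℝ)|) * |(k : ℝ)| ^ (-(1 - H)) := by
      rw [hρ.eq_of_ne_zero k hk', mul_right_comm, ← Real.rpow_add hkp, mul_comm]
      congr 2; ring
    have h4 : |(k : ℝ)| ^ (-(1 - H)) ≤ 2 ^ (1 - H) * (1 + |(k : ℝ)|) ^ (-(1 - H)) := by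
      have hone : (1 : ℝ) ≤ |(k : ℝ)| := by linarith
      rw [Real.rpow_neg hk0, Real.rpow_neg (by positivity), ← div_eq_mul_inv,
        inv_le_iff_one_le_mul₀ (by positivity), div_mul_eq_mul_div, one_le_div (by positivity),
        ← Real.mul_rpow (by norm_num) hk0]
      exact Real.rpow_le_rpow (by positivity) (by linarith) hH.le
    have h5 : 0 ≤ (x₀ + 2) ^ (1 - H) * (1 + |(k : ℝ)|) ^ (-(1 - H)) := by positivity
    calc ρ k ≤ M * |(k : ℝ)| ^ (-(1 - H)) := by rw [h3]; gcongr
      _ ≤ M * (2 ^ (1 - H) * (1 + |(k : ℝ)|) ^ (-(1 - H))) := by gcongr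
      _ ≤ _ := by linarith

/-! ### The Gaussian noise -/

namespace IsStationaryGaussianNoise

lemma memLp (hξ : IsStationaryGaussianNoise P ξ ρ) (t : ℤ) : MemLp (ξ t) 2 P :=
  (hξ.gaussian.hasGaussianLaw_eval t).memLp_two

lemma integrable_mul (hξ : IsStationaryGaussianNoise P ξ ρ) (s t : ℤ) :
    Integrable (fun ω => ξ s ω * ξ t ω) P :=
  (hξ.memLp s).integrable_mul (hξ.memLp t)

lemma integral_mul (hξ : IsStationaryGaussianNoise P ξ ρ) (s t : ℤ) :
    ∫ ω, ξ s ω * ξ t ω ∂P = ρ (t - s) := by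
  simpa using hξ.covariance s (t - s)

lemma integral_sq (hξ : IsStationaryGaussianNoise P ξ ρ) (h0 : ρ 0 = 1) (t : ℤ) :
    ∫ ω, ξ t ω ^ 2 ∂P = 1 := by
  simpa [sq, h0] using hξ.integral_mul t t

lemma integral_abs_mul_le (hξ : IsStationaryGaussianNoise P ξ ρ) (h0 : ρ 0 = 1) (s t : ℤ) :
    ∫ ω, |ξ s ω * ξ t ω| ∂P ≤ 1 := by
  have hs := (hξ.memLp s).integrable_sq
  have ht := (hξ.memLp t).integrable_sq
  calc ∫ ω, |ξ s ω * ξ t ω| ∂P ≤ ∫ ω, (ξ s ω ^ 2 + ξ t ω ^ 2) / 2 ∂P := by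
        refine integral_mono (hξ.integrable_mul s t).abs ((hs.add ht).div_const 2) fun ω => ?_
        simp only [abs_mul]
        nlinarith [sq_nonneg (|ξ s ω| - |ξ t ω|), sq_abs (ξ s ω), sq_abs (ξ t ω)]
    _ = 1 := by
        rw [integral_div, integral_add hs ht, hξ.integral_sq h0, hξ.integral_sq h0]; norm_num

lemma covariance_le_one (hξ : IsStationaryGaussianNoise P ξ ρ) (h0 : ρ 0 = 1) (k : ℤ) :
    ρ k ≤ 1 := by
  have h := hξ.integral_mul 0 k
  rw [sub_zero] at h
  rw [← h]
  exact (le_abs_self _).trans ((abs_integral_le_integral_abs).trans (hξ.integral_abs_mul_le h0 0 k))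

/-! ### The stationary solution -/

lemma summable_pow_add {ϑ : ℝ} (h0 : 0 ≤ ϑ) (h1 : ϑ < 1) :
    Summable fun p : ℕ × ℕ => ϑ ^ (p.1 + p.2) := by
  have h := summable_geometric_of_lt_one h0 h1
  simpa only [pow_add] using h.mul_of_nonneg h (fun _ => pow_nonneg h0 _) fun _ => pow_nonneg h0 _

lemma ae_summable_norm [IsProbabilityMeasure P] (hξ : IsStationaryGaussianNoise P ξ ρ)
    (h0 : ρ 0 = 1) {ϑ : ℝ} (hϑ : ϑ ∈ Ioo (0 : ℝ) 1) (t : ℤ) :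
    ∀ᵐ ω ∂P, Summable fun j : ℕ => ‖ϑ ^ j * ξ (t - j) ω‖ := by
  have hi : ∀ j : ℕ, Integrable (fun ω => ϑ ^ j * ξ (t - j) ω) P := fun j =>
    ((hξ.memLp _).integrable one_le_two).const_mul _
  refine ae_summable_of_summable_integral_norm hi ?_
  refine Summable.of_nonneg_of_le (fun j => integral_nonneg fun _ => norm_nonneg _) (fun j => ?_)
    (summable_geometric_of_lt_one hϑ.1.le hϑ.2)
  have hs := (hξ.memLp (t - j)).integrable_sq
  have h1 : ∫ ω, ‖ξ (t - j) ω‖ ∂P ≤ 1 := by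
    calc ∫ ω, ‖ξ (t - j) ω‖ ∂P ≤ ∫ ω, (ξ (t - j) ω ^ 2 + 1) / 2 ∂P := by
          refine integral_mono ((hξ.memLp _).integrable one_le_two).norm
            ((hs.add (integrable_const 1)).div_const 2) fun ω => ?_
          simp only [Real.norm_eq_abs]
          nlinarith [sq_nonneg (|ξ (t - j) ω| - 1), sq_abs (ξ (t - j) ω)]
      _ = 1 := by
          rw [integral_div, integral_add hs (integrable_const 1), hξ.integral_sq h0,
            integral_const, probReal_univ]
          norm_num
  simp_rw [norm_mul]
  rw [integral_const_mul, Real.norm_of_nonneg (pow_nonneg hϑ.1.le j)]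
  exact mul_le_of_le_one_right (pow_nonneg hϑ.1.le j) h1

/-- The squared series is an absolutely convergent double series, integrated termwise because E|ξ_s
ξ_t| ≤ 1. The time `t` cancels from the covariances. -/
lemma hasSum_integral_statProcess_sq [IsProbabilityMeasure P]
    (hξ : IsStationaryGaussianNoise P ξ ρ) (h0 : ρ 0 = 1) {ϑ : ℝ} (hϑ : ϑ ∈ Ioo (0 : ℝ) 1)
    (t : ℤ) :
    HasSum (fun p : ℕ × ℕ => ϑ ^ (p.1 + p.2) * ρ (p.1 - p.2))
      (∫ ω, statProcess ϑ ξ t ω ^ 2 ∂P) := by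
  set F : ℕ × ℕ → Ω → ℝ := fun p ω =>
    (ϑ ^ p.1 * ξ (t - p.1) ω) * (ϑ ^ p.2 * ξ (t - p.2) ω) with hF
  have hF' : ∀ p, F p = fun ω => ϑ ^ (p.1 + p.2) * (ξ (t - p.1) ω * ξ (t - p.2) ω) := by
    intro p; ext ω; simp only [hF]; ring
  have hFi : ∀ p, Integrable (F p) P := by
    intro p; rw [hF']; exact (hξ.integrable_mul _ _).const_mul _
  have hsum : Summable fun p => ∫ ω, ‖F p ω‖ ∂P := by
    refine Summable.of_nonneg_of_le (fun j => integral_nonneg fun _ => norm_nonneg _)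
      (fun p => ?_) (summable_pow_add hϑ.1.le hϑ.2)
    rw [hF']
    simp_rw [norm_mul (ϑ ^ _)]
    rw [integral_const_mul, Real.norm_of_nonneg (pow_nonneg hϑ.1.le _)]
    exact mul_le_of_le_one_right (pow_nonneg hϑ.1.le _) (hξ.integral_abs_mul_le h0 _ _)
  have h := hasSum_integral_of_summable_integral_norm hFi hsum
  have e : ∫ ω, ∑' p, F p ω ∂P = ∫ ω, statProcess ϑ ξ t ω ^ 2 ∂P := by
    refine integral_congr_ae ?_
    filter_upwards [hξ.ae_summable_norm h0 hϑ t] with ω hω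
    rw [statProcess, sq, tsum_mul_tsum_of_summable_norm hω hω]
  rw [e] at h
  refine h.congr_fun ?_
  intro p
  rw [hF', integral_const_mul, hξ.integral_mul]
  congr 2; ring

lemma aemeasurable_statProcess [IsProbabilityMeasure P]
    (hξ : IsStationaryGaussianNoise P ξ ρ) (h0 : ρ 0 = 1) {ϑ : ℝ} (hϑ : ϑ ∈ Ioo (0 : ℝ) 1)
    (t : ℤ) : AEMeasurable (statProcess ϑ ξ t) P := by
  refine aemeasurable_of_tendsto_metrizable_ae atTop
    (f := fun n ω => ∑ j ∈ Finset.range n, ϑ ^ j * ξ (t - j) ω) (fun n => ?_) ?_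
  · exact Finset.aemeasurable_fun_sum _ fun j _ =>
      (hξ.gaussian.hasGaussianLaw_eval _).aemeasurable.const_mul _
  · filter_upwards [hξ.ae_summable_norm h0 hϑ t] with ω hω
    exact hω.of_norm.hasSum.tendsto_sum_nat

lemma integral_statProcess_sq [IsProbabilityMeasure P]
    (hξ : IsStationaryGaussianNoise P ξ ρ) (h0 : ρ 0 = 1) {ϑ : ℝ} (hϑ : ϑ ∈ Ioo (0 : ℝ) 1)
    (t : ℤ) : ∫ ω, statProcess ϑ ξ t ω ^ 2 ∂P = secondMoment P ξ ϑ :=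
  (hξ.hasSum_integral_statProcess_sq h0 hϑ t).unique (hξ.hasSum_integral_statProcess_sq h0 hϑ 0)

lemma hasSum_secondMoment [IsProbabilityMeasure P]
    (hξ : IsStationaryGaussianNoise P ξ ρ) (h0 : ρ 0 = 1) {ϑ : ℝ} (hϑ : ϑ ∈ Ioo (0 : ℝ) 1) :
    HasSum (fun p : ℕ × ℕ => ϑ ^ (p.1 + p.2) * ρ (p.1 - p.2)) (secondMoment P ξ ϑ) :=
  hξ.hasSum_integral_statProcess_sq h0 hϑ 0

lemma secondMoment_pos [IsProbabilityMeasure P] (hξ : IsStationaryGaussianNoise P ξ ρ)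
    (h0 : ρ 0 = 1) (hn : ∀ k, 0 ≤ ρ k) {ϑ : ℝ} (hϑ : ϑ ∈ Ioo (0 : ℝ) 1) :
    0 < secondMoment P ξ ϑ := by
  have h := le_hasSum (hξ.hasSum_secondMoment h0 hϑ) (0, 0) fun p _ =>
    mul_nonneg (pow_nonneg hϑ.1.le _) (hn _)
  simp only [add_zero, pow_zero, Nat.cast_zero, sub_zero, h0, mul_one] at h
  linarith

lemma memLp_statProcess [IsProbabilityMeasure P] (hξ : IsStationaryGaussianNoise P ξ ρ)
    (h0 : ρ 0 = 1) (hn : ∀ k, 0 ≤ ρ k) {ϑ : ℝ} (hϑ : ϑ ∈ Ioo (0 : ℝ) 1) (t : ℤ) :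
    MemLp (statProcess ϑ ξ t) 2 P := by
  rw [memLp_two_iff_integrable_sq (hξ.aemeasurable_statProcess h0 hϑ t).aestronglyMeasurable]
  -- A non-integrable function has integral 0 by convention, so positivity of the second moment
  -- gives integrability.
  refine Integrable.of_integral_ne_zero ?_
  rw [hξ.integral_statProcess_sq h0 hϑ t]
  exact (hξ.secondMoment_pos h0 hn hϑ).ne'

lemma strictMonoOn_secondMoment [IsProbabilityMeasure P] (hξ : IsStationaryGaussianNoise P ξ ρ)
    (h0 : ρ 0 = 1) (hn : ∀ k, 0 ≤ ρ k) : StrictMonoOn (secondMoment P ξ) (Ioo 0 1) := by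
  intro a ha b hb hab
  -- The (0, 0) term is constant; the (1, 1) term is ϑ² and grows strictly.
  refine hasSum_lt (i := (1, 1)) (fun p => ?_) ?_ (hξ.hasSum_secondMoment h0 ha)
    (hξ.hasSum_secondMoment h0 hb)
  · exact mul_le_mul_of_nonneg_right (pow_le_pow_left₀ ha.1.le hab.le _) (hn _)
  · simp only [sub_self, h0, mul_one]
    exact pow_lt_pow_left₀ hab ha.1.le (by norm_num)

lemma continuousOn_secondMoment [IsProbabilityMeasure P] (hξ : IsStationaryGaussianNoise P ξ ρ)
    (h0 : ρ 0 = 1) (hn : ∀ k, 0 ≤ ρ k) : ContinuousOn (secondMoment P ξ) (Ioo 0 1) := by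
  intro x hx
  -- On (0, b) with b < 1 the series is dominated by ∑ b^(i+j), so it converges uniformly there.
  obtain ⟨b, hxb, hb⟩ := exists_between hx.2
  have hc : ContinuousOn (secondMoment P ξ) (Ioo 0 b) := by
    have h := continuousOn_tsum (s := Ioo (0 : ℝ) b)
      (f := fun (p : ℕ × ℕ) (x : ℝ) => x ^ (p.1 + p.2) * ρ (p.1 - p.2))
      (fun p => by fun_prop) (summable_pow_add (hx.1.trans hxb).le hb) (fun p y hy => by
        rw [norm_mul, Real.norm_of_nonneg (pow_nonneg hy.1.le _), Real.norm_of_nonneg (hn _)]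
        exact (mul_le_of_le_one_right (pow_nonneg hy.1.le _) (hξ.covariance_le_one h0 _)).trans
          (pow_le_pow_left₀ hy.1.le hy.2.le _))
    exact h.congr fun y hy => (hξ.hasSum_secondMoment h0 ⟨hy.1, hy.2.trans hb⟩).tsum_eq.symm
  exact (hc.continuousAt (Ioo_mem_nhds hx.1 hxb)).continuousWithinAt

end IsStationaryGaussianNoise

/-! ### The autoregressive process -/

/-- Because X starts at 0, unrolling the recursion gives the stationary series truncated at j < t.
-/
lemma arProcess_eq_sum {α : Type*} (θ : ℝ) (ξ : ℤ → α → ℝ) (t : ℕ) (ω : α) :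
    arProcess θ ξ t ω = ∑ j ∈ Finset.range t, θ ^ j * ξ (t - j) ω := by
  induction t with
  | zero => simp [arProcess]
  | succ t ih =>
    simp only [arProcess]
    rw [ih, Finset.sum_range_succ', Finset.mul_sum]
    congr 1
    · refine Finset.sum_congr rfl fun j _ => ?_
      rw [show (((t + 1 : ℕ) : ℤ) - ((j + 1 : ℕ) : ℤ)) = (t : ℤ) - j by push_cast; ring]
      ring
    · simp

lemma isGaussianProcess_arProcess (hξ : IsGaussianProcess ξ P) (θ : ℝ) :
    IsGaussianProcess (arProcess θ ξ) P := by
  classical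
  refine hξ.of_isGaussianProcess fun t =>
    ⟨(Finset.range t).image fun j : ℕ => (t : ℤ) - j,
      ∑ j : Finset.range t, θ ^ (j : ℕ) •
        ContinuousLinearMap.proj ⟨(t : ℤ) - j, Finset.mem_image_of_mem _ j.2⟩, fun ω => ?_⟩
  rw [arProcess_eq_sum, ← Finset.sum_coe_sort]
  simp

lemma integral_arProcess (hξ : IsStationaryGaussianNoise P ξ ρ) (θ : ℝ) (t : ℕ) :
    ∫ ω, arProcess θ ξ t ω ∂P = 0 := by
  simp_rw [arProcess_eq_sum]
  rw [integral_finsetSum _ fun j _ =>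
    ((hξ.gaussian.hasGaussianLaw_eval _).integrable).const_mul _]
  simp [integral_const_mul, hξ.centred]

lemma integral_arProcess_mul (hξ : IsStationaryGaussianNoise P ξ ρ) (θ : ℝ) (s t : ℕ) :
    ∫ ω, arProcess θ ξ s ω * arProcess θ ξ t ω ∂P =
      ∑ i ∈ Finset.range s, ∑ j ∈ Finset.range t, θ ^ (i + j) * ρ ((t - j) - (s - i)) := by
  have e : ∀ ω, arProcess θ ξ s ω * arProcess θ ξ t ω =
      ∑ i ∈ Finset.range s, ∑ j ∈ Finset.range t,
        θ ^ (i + j) * (ξ (s - i) ω * ξ (t - j) ω) := by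
    intro ω
    rw [arProcess_eq_sum, arProcess_eq_sum, Finset.sum_mul_sum]
    refine Finset.sum_congr rfl fun i _ => Finset.sum_congr rfl fun j _ => ?_
    ring
  have hint : ∀ i j : ℕ, Integrable (fun ω => θ ^ (i + j) * (ξ (s - i) ω * ξ (t - j) ω)) P :=
    fun i j => (hξ.integrable_mul _ _).const_mul _
  simp_rw [e]
  rw [integral_finsetSum _ fun i _ => integrable_finsetSum _ fun j _ => hint i j]
  simp_rw [integral_finsetSum _ fun j (_ : j ∈ Finset.range t) => hint _ j, integral_const_mul,
    hξ.integral_mul]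

/-- E X_t² is the partial sum of the double series for f(θ) over the square [0, t)², and these
squares exhaust ℕ × ℕ. -/
lemma tendsto_integral_arProcess_sq [IsProbabilityMeasure P]
    (hξ : IsStationaryGaussianNoise P ξ ρ) (h0 : ρ 0 = 1) {θ : ℝ} (hθ : θ ∈ Ioo (0 : ℝ) 1) :
    Tendsto (fun t => ∫ ω, arProcess θ ξ t ω ^ 2 ∂P) atTop (𝓝 (secondMoment P ξ θ)) := by
  have hmono : Monotone fun t : ℕ => Finset.range t ×ˢ Finset.range t := fun a b hab =>
    Finset.product_subset_product (Finset.range_mono hab) (Finset.range_mono hab)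
  have htop : Tendsto (fun t : ℕ => Finset.range t ×ˢ Finset.range t) atTop atTop := by
    refine tendsto_atTop_finset_of_monotone hmono fun p => ⟨max p.1 p.2 + 1, ?_⟩
    simp only [Finset.mem_product, Finset.mem_range]
    omega
  refine ((hξ.hasSum_secondMoment h0 hθ).comp htop).congr fun t => ?_
  simp_rw [sq]
  rw [integral_arProcess_mul hξ, Function.comp, Finset.sum_product]
  refine Finset.sum_congr rfl fun i _ => Finset.sum_congr rfl fun j _ => ?_
  congr 2; ring

/-- The triangle inequality in product form, 1 + d ≤ (1 + x)(1 + a)(1 + b), raised to a power ε ≤ 1: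
shifting the argument by a and b costs at most (1 + a)(1 + b). -/
lemma one_add_rpow_neg_le {ε x : ℝ} (hε0 : 0 ≤ ε) (hε1 : ε ≤ 1) (hx : 0 ≤ x) {d a b : ℝ}
    (hd : 0 ≤ d) (ha : 0 ≤ a) (hb : 0 ≤ b) (h : d ≤ x + a + b) :
    (1 + x) ^ (-ε) ≤ (1 + d) ^ (-ε) * ((1 + a) * (1 + b)) := by
  have hab : 1 ≤ (1 + a) * (1 + b) := by nlinarith [mul_nonneg ha hb]
  have hle : 1 + d ≤ (1 + x) * ((1 + a) * (1 + b)) := by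
    nlinarith [mul_nonneg ha hb, mul_nonneg hx ha, mul_nonneg hx hb,
      mul_nonneg hx (mul_nonneg ha hb)]
  have h1 : (1 + d) ^ ε ≤ (1 + x) ^ ε * ((1 + a) * (1 + b)) := by
    calc (1 + d) ^ ε ≤ ((1 + x) * ((1 + a) * (1 + b))) ^ ε :=
          Real.rpow_le_rpow (by linarith) hle hε0
      _ = (1 + x) ^ ε * ((1 + a) * (1 + b)) ^ ε := Real.mul_rpow (by linarith) (by linarith)
      _ ≤ _ := by
          gcongr
          exact Real.rpow_le_self_of_one_le hab hε1
  rw [Real.rpow_neg (by linarith), Real.rpow_neg (by linarith),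
    inv_le_iff_one_le_mul₀ (by positivity), mul_assoc, inv_mul_eq_div, one_le_div (by positivity)]
  linarith

/-- Lags i and j move the time difference by at most i + j; the cost (1 + i)(1 + j) is paid by
θ^(i+j), since S = ∑ θ^i (1 + i) is finite. -/
lemma exists_abs_integral_arProcess_mul_le (hξ : IsStationaryGaussianNoise P ξ ρ)
    (hρ : IsLongMemoryCovariance ρ H L) {θ : ℝ} (hθ : θ ∈ Ioo (0 : ℝ) 1) :
    ∃ B, ∀ s t, |∫ ω, arProcess θ ξ s ω * arProcess θ ξ t ω ∂P| ≤
      B * (1 + (Nat.dist s t : ℝ)) ^ (-(1 - H)) := by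
  obtain ⟨C, hC, hCρ⟩ := hρ.exists_le_rpow (hξ.covariance_le_one hρ.zero)
  have hθ0 := hθ.1.le
  have hsumm : Summable fun i : ℕ => θ ^ i * (1 + (i : ℝ)) := by
    have h1 := summable_geometric_of_lt_one hθ0 hθ.2
    have h2 := summable_pow_mul_geometric_of_norm_lt_one 1
      (show ‖θ‖ < 1 by rw [Real.norm_of_nonneg hθ0]; exact hθ.2)
    refine (h1.add h2).congr fun i => ?_
    ring
  set S := ∑' i : ℕ, θ ^ i * (1 + (i : ℝ)) with hS
  have hSle : ∀ n : ℕ, ∑ i ∈ Finset.range n, θ ^ i * (1 + (i : ℝ)) ≤ S := fun n =>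
    hsumm.sum_le_tsum _ fun i _ => by positivity
  have hSnn : ∀ n : ℕ, 0 ≤ ∑ i ∈ Finset.range n, θ ^ i * (1 + (i : ℝ)) := fun n =>
    Finset.sum_nonneg fun i _ => by positivity
  refine ⟨C * (S * S), fun s t => ?_⟩
  rw [integral_arProcess_mul hξ, abs_of_nonneg (Finset.sum_nonneg fun i _ =>
    Finset.sum_nonneg fun j _ => mul_nonneg (pow_nonneg hθ0 _) (hρ.nonneg _))]
  set q := (1 + (Nat.dist s t : ℝ)) ^ (-(1 - H)) with hq
  have hq0 : 0 ≤ q := by positivity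
  have hterm : ∀ i j : ℕ, θ ^ (i + j) * ρ ((t - j) - (s - i)) ≤
      C * q * ((θ ^ i * (1 + (i : ℝ))) * (θ ^ j * (1 + (j : ℝ)))) := by
    intro i j
    have hdist : (Nat.dist s t : ℝ) ≤ |(((t - j) - (s - i) : ℤ) : ℝ)| + i + j := by
      have hz : (Nat.dist s t : ℤ) ≤ |((t : ℤ) - j) - (s - i)| + i + j := by
        simp only [Nat.dist]
        rcases abs_cases (((t : ℤ) - j) - (s - i)) with h | h <;> omega
      exact_mod_cast hz
    have hrp := one_add_rpow_neg_le (ε := 1 - H) (by linarith [hρ.lt_one])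
      (by linarith [hρ.half_lt]) (abs_nonneg _) (Nat.cast_nonneg _) i.cast_nonneg j.cast_nonneg
      hdist
    calc θ ^ (i + j) * ρ ((t - j) - (s - i))
        ≤ θ ^ (i + j) * (C * (q * ((1 + (i : ℝ)) * (1 + j)))) := by
          gcongr
          exact (hCρ _).trans (mul_le_mul_of_nonneg_left hrp hC)
      _ = _ := by ring
  calc _ ≤ ∑ i ∈ Finset.range s, ∑ j ∈ Finset.range t,
        C * q * ((θ ^ i * (1 + (i : ℝ))) * (θ ^ j * (1 + (j : ℝ)))) := by
        exact Finset.sum_le_sum fun i _ => Finset.sum_le_sum fun j _ => hterm i j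
    _ = C * q * ((∑ i ∈ Finset.range s, θ ^ i * (1 + (i : ℝ))) *
        ∑ j ∈ Finset.range t, θ ^ j * (1 + (j : ℝ))) := by
        rw [Finset.sum_mul_sum]; simp_rw [Finset.mul_sum]
    _ ≤ C * q * (S * S) := by
        exact mul_le_mul_of_nonneg_left
          (mul_le_mul (hSle s) (hSle t) (hSnn t) ((hSnn s).trans (hSle s))) (mul_nonneg hC hq0)
    _ = _ := by ring

end LongMemoryAR

/-- Strong consistency of the second moment estimator. The first two parts of the conclusion say
that the objects in it are well defined: the series for the stationary solution converges almost
surely, its second moment is finite and does not depend on the time, and `f` is positive and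
strictly increasing on `(0, 1)`. The third part says that almost surely, for all large `n`, the
empirical second moment lies in the range of `f` on `(0, 1)`, and that the estimator converges
to `θ`. -/
theorem theorem1p1 {Ω : Type*} [MeasurableSpace Ω] (P : Measure Ω) [IsProbabilityMeasure P]
    (ξ : ℤ → Ω → ℝ) (ρ : ℤ → ℝ) (H : ℝ) (L : ℝ → ℝ)
    (hρ : LongMemoryAR.IsLongMemoryCovariance ρ H L)
    (hξ : LongMemoryAR.IsStationaryGaussianNoise P ξ ρ)
    (θ : ℝ) (hθ : θ ∈ Ioo (0 : ℝ) 1) :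
    (∀ ϑ ∈ Ioo (0 : ℝ) 1, ∀ t : ℤ,
      (∀ᵐ ω ∂P, Summable fun j : ℕ => ϑ ^ j * ξ (t - j) ω) ∧
      MemLp (LongMemoryAR.statProcess ϑ ξ t) 2 P ∧
      ∫ ω, LongMemoryAR.statProcess ϑ ξ t ω ^ 2 ∂P = LongMemoryAR.secondMoment P ξ ϑ) ∧
    ((∀ ϑ ∈ Ioo (0 : ℝ) 1, 0 < LongMemoryAR.secondMoment P ξ ϑ) ∧
      StrictMonoOn (LongMemoryAR.secondMoment P ξ) (Ioo 0 1)) ∧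
    ∀ᵐ ω ∂P,
      (∀ᶠ n : ℕ in atTop,
        LongMemoryAR.empiricalMoment (LongMemoryAR.arProcess θ ξ) n ω ∈
          LongMemoryAR.secondMoment P ξ '' Ioo 0 1) ∧
      Tendsto
        (fun n : ℕ => LongMemoryAR.momentEstimator P ξ (LongMemoryAR.arProcess θ ξ) n ω)
        atTop (𝓝 θ) := by
  have h0 := hρ.zero
  have hn := hρ.nonneg
  refine ⟨fun ϑ hϑ t => ⟨?_, hξ.memLp_statProcess h0 hn hϑ t, hξ.integral_statProcess_sq h0 hϑ t⟩,
    ⟨fun ϑ hϑ => hξ.secondMoment_pos h0 hn hϑ, hξ.strictMonoOn_secondMoment h0 hn⟩, ?_⟩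
  · exact (hξ.ae_summable_norm h0 hϑ t).mono fun ω hω => hω.of_norm
  obtain ⟨B, hB⟩ := LongMemoryAR.exists_abs_integral_arProcess_mul_le hξ hρ hθ
  have hdist : ∀ i j, Nat.dist (i + 1) (j + 1) = Nat.dist i j := fun i j => Nat.dist_add_add_right ..
  -- The empirical moment runs over 1 ≤ t ≤ n, hence the shift of X by one.
  have hlim := LongMemoryAR.tendsto_average_sq_of_isGaussianProcess
    (Z := fun i => LongMemoryAR.arProcess θ ξ (i + 1)) (ε := 1 - H)
    ((LongMemoryAR.isGaussianProcess_arProcess hξ.gaussian θ).comp_right (· + 1))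
    (fun i => LongMemoryAR.integral_arProcess hξ θ _) (by linarith [hρ.lt_one])
    (by linarith [hρ.half_lt]) (fun i j => hdist i j ▸ hB (i + 1) (j + 1))
    ((LongMemoryAR.tendsto_integral_arProcess_sq hξ h0 hθ).comp (tendsto_add_atTop_nat 1))
  filter_upwards [hlim] with ω hω
  refine LongMemoryAR.tendsto_invFunOn_Ioo (hξ.strictMonoOn_secondMoment h0 hn)
    (hξ.continuousOn_secondMoment h0 hn) hθ (hω.congr fun n => ?_)
  rw [LongMemoryAR.empiricalMoment, ← Finset.Ico_add_one_right_eq_Icc,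
    Finset.sum_Ico_eq_sum_range, one_div, inv_mul_eq_div]
  simp [add_comm]
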